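/- A virtual link diagram is a generic immersion of finitely many circles in the oriented plane (finitely many transverse double points, no other multiple points), each double point being marked either as a virtual crossing or as a classical crossing with a chosen overpass; components are unoriented and diagrams are taken up to planar isotopy. The generalized Reidemeister moves are the classical first, second and third moves, the virtual first, second and third moves, and the mixed third move, in which a strand with only virtual crossings is moved across a classical crossing. Two diagrams are equivalent if they are joined by a finite sequence of generalized Reidemeister moves and planar isotopies. The atom of a diagram $K$ is the closed surface $P$ with an embedded graph $\Gamma$ obtained as follows. The 4-valent graph $\Gamma$ has the classical crossings of $K$ as vertices and the arcs of $K$ between them as edges, virtual crossings being disregarded (a component without classical crossings gives a circle without vertices). Black 2-cells are glued to $\Gamma$ along the circles of the state in which every classical crossing gets the $A$-smoothing, and white 2-cells along the circles of the state in which every classical crossing gets the $B$-smoothing. Thus every edge is incident to one black and one white cell. The diagram $K$ has an orientable atom if $P$ is orientable. **Theorem 3.1.** Let $K$ and $K'$ be equivalent virtual link diagrams which both have orientable atoms. Then there is a finite sequence of virtual link diagrams $$K=K_1\to K_2\to\dots\to K_n=K'$$ such that every $K_i$ has an orientable atom and, for $2\le i\le n$, the diagram $K_i$ is obtained from $K_{i-1}$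 by one generalized Reidemeister move or by a planar isotopy. -/

import Mathlib

/-- The decoration of a node of a diagram, as seen by a half-edge (dart) at that node: an auxiliary
2-valent point on the curve, a virtual crossing, or a classical crossing at which the dart lies on
the overpass or on the underpass. -/
inductive Mark : Type
  | point
  | virt
  | over
  | under

/-- The decoration seen by the neighbouring dart of the same node. -/
def Mark.next : Mark → Mark
  | .point => .point
  | .virt => .virt
  | .over => .under
  | .under => .over

/-- Incidences of darts with the other darts of their node, with the other dart of their edge, and
with regions. -/
inductive Touch {Dart Region : Type} (rot opp : Dart → Dart) (region : Dart → Region) :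
    Dart ⊕ Region → Dart ⊕ Region → Prop
  | rot (d : Dart) : Touch rot opp region (Sum.inl d) (Sum.inl (rot d))
  | opp (d : Dart) : Touch rot opp region (Sum.inl d) (Sum.inl (opp d))
  | region (d : Dart) : Touch rot opp region (Sum.inl d) (Sum.inr (region d))

/-- An (unoriented) virtual link diagram in the oriented plane, up to orientation preserving
homeomorphism of the plane: a generic immersed system of closed curves, each double point of which
is a virtual crossing or a classical crossing with a chosen overpass.

The curves are cut into edges by their crossings and by finitely many auxiliary 2-valent points
(at least one on each curve without crossings).  `Dart` is the set of half-edges, each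
attached to a node (a crossing or an auxiliary point).  The complement of the curves in the plane
is the disjoint union of the regions, which need not be simply connected as the diagram need not
be connected. -/
structure VirtualDiagram where
  /-- half-edges -/
  Dart : Type
  /-- connected components of the complement of the curves in the plane -/
  Region : Type
  finite_dart : Finite Dart
  finite_region : Finite Region
  /-- the next dart at the same node, counterclockwise -/
  rot : Equiv.Perm Dart
  /-- the other half of the same edge -/
  opp : Dart → Dart
  /-- the decoration of the node, as seen by the dart -/
  mark : Dart → Mark
  /-- the region which contains the corner between the dart `d` and the dart `rot d`; it is on the
  left of `d` for an observer who leaves the node along `d` -/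
  region : Dart → Region
  /-- the unbounded region -/
  outer : Region
  opp_opp : ∀ d, opp (opp d) = d
  opp_ne : ∀ d, opp d ≠ d
  rot_ne : ∀ d, rot d ≠ d
  /-- an auxiliary point has two darts -/
  rot_point : ∀ d, mark d = Mark.point → rot (rot d) = d
  /-- a crossing has four darts -/
  rot_crossing : ∀ d, mark d ≠ Mark.point → rot (rot (rot (rot d))) = d ∧ rot (rot d) ≠ d
  /-- opposite darts of a crossing have the same level, neighbouring darts have opposite levels -/
  mark_rot : ∀ d, mark (rot d) = (mark d).next
  /-- the region does not change along an edge -/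
  region_opp : ∀ d, region (rot.symm (opp d)) = region d
  /-- the sphere is connected -/
  connected : Subsingleton (Quot (Touch rot opp region))
  /-- Euler's formula `V - E + F = 1 + C` for a plane graph with `C` connected components -/
  euler : Nat.card (Quot fun d e => e = rot d) + Nat.card Region =
    Nat.card (Quot fun d e => e = opp d) + Nat.card (Quot fun d e => e = rot d ∨ e = opp d) + 1

/-- A combinatorial atom: a closed surface `P` glued from black and white 2-cells along a
4-valent graph (the frame), each edge of which is incident to one black and one white cell.

The frame is given by its half-edges; its edges may be subdivided by 2-valent vertices, so that
frames with circles free of 4-valent vertices are included.  At a vertex, the cells fill the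
corners: `corner c h` is the half-edge on the other side of the corner at `h` of colour `c`
(`true` for black, `false` for white).  So a cell of colour `c` is a polygon, whose boundary
circuit is traced by applying `edge` and `corner c` alternately. -/
structure Atom where
  /-- half-edges of the frame -/
  Half : Type
  /-- the other half of the same edge -/
  edge : Half → Half
  /-- the half-edge across the corner of the given colour -/
  corner : Bool → Half → Half
  edge_edge : ∀ h, edge (edge h) = h
  edge_ne : ∀ h, edge h ≠ h
  corner_corner : ∀ c h, corner c (corner c h) = h
  corner_ne : ∀ c h, corner c h ≠ h
  /-- a vertex has two half-edges, or four half-edges with corners of alternating colours -/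
  valency : ∀ h, corner true h = corner false h ∨
    (corner true h ≠ corner false h ∧
      corner true (corner false h) = corner false (corner true h))

/-- The surface of an atom is orientable: its 2-cells can be oriented so that the two cells at each
edge induce opposite directions on it.  An orientation of the cells is recorded by the direction of
their boundary circuits: `dir c h` is true if the boundary of the cell of colour `c` at `h` runs
along `h` towards the vertex of `h`, and false if it runs away from this vertex. -/
def Atom.Orientable (A : Atom) : Prop :=
  ∃ dir : Bool → A.Half → Bool,
    (∀ c h, dir c (A.edge h) = !(dir c h)) ∧
    (∀ c h, dir c (A.corner c h) = !(dir c h)) ∧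
    (∀ h, dir false h = !(dir true h))

namespace VirtualDiagram

/-- The corners of the atom of a diagram.  At a classical crossing, the black corners are cut off by
the A-smoothing (which joins the two regions that the overpass sweeps when it is turned
counterclockwise to the underpass) and the white ones by the B-smoothing.  At an auxiliary point
and at a virtual crossing, the strand goes straight on. -/
def atomCorner (D : VirtualDiagram) (black : Bool) (d : D.Dart) : D.Dart :=
  match D.mark d, black with
  | .point, _ => D.rot d
  | .virt, _ => D.rot (D.rot d)
  | .over, true => D.rot.symm d
  | .over, false => D.rot d
  | .under, true => D.rot d
  | .under, false => D.rot.symm d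

theorem mark_rot_symm (D : VirtualDiagram) (d : D.Dart) :
    D.mark (D.rot.symm d) = (D.mark d).next := by
  have h := D.mark_rot (D.rot.symm d)
  rw [Equiv.apply_symm_apply] at h
  rw [h]
  cases D.mark (D.rot.symm d) <;> rfl

theorem rot_rot_symm (D : VirtualDiagram) (d : D.Dart) (h : D.mark d ≠ Mark.point) :
    D.rot.symm d = D.rot (D.rot (D.rot d)) := by
  rw [Equiv.symm_apply_eq]
  exact (D.rot_crossing d h).1.symm

theorem rot_symm_ne (D : VirtualDiagram) (d : D.Dart) : D.rot.symm d ≠ d := by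
  intro h
  rw [Equiv.symm_apply_eq] at h
  exact D.rot_ne d h.symm

/-- The atom of a virtual diagram.  The vertices of its frame are the classical crossings (virtual
crossings are disregarded: each of the two strands there only contributes a 2-valent vertex). -/
def atom (D : VirtualDiagram) : Atom where
  Half := D.Dart
  edge := D.opp
  corner := D.atomCorner
  edge_edge := D.opp_opp
  edge_ne := D.opp_ne
  corner_corner c d := by
    have h1 := D.mark_rot d
    have h2 := D.mark_rot (D.rot d)
    have h3 := D.mark_rot_symm d
    have h4 := D.rot_point d
    have h5 := D.rot_crossing d
    rcases hm : D.mark d <;> cases c <;> simp_all [atomCorner, Mark.next]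
  corner_ne c d := by
    have h3 := D.rot_symm_ne d
    have h4 := D.rot_ne d
    have h5 := D.rot_crossing d
    rcases hm : D.mark d <;> cases c <;> simp_all [atomCorner]
  valency d := by
    have h1 := D.mark_rot d
    have h3 := D.mark_rot_symm d
    have h5 := D.rot_crossing d
    have h6 := D.rot_rot_symm d
    rcases hm : D.mark d <;> simp_all [atomCorner, Mark.next]
    all_goals exact em _

/-- Isomorphism of decorated plane graphs. -/
structure Iso (D E : VirtualDiagram) where
  dart : D.Dart ≃ E.Dart
  reg : D.Region ≃ E.Region
  rot_dart : ∀ d, E.rot (dart d) = dart (D.rot d)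
  opp_dart : ∀ d, E.opp (dart d) = dart (D.opp d)
  mark_dart : ∀ d, E.mark (dart d) = D.mark d
  region_dart : ∀ d, E.region (dart d) = reg (D.region d)
  outer_reg : reg D.outer = E.outer

/-- `E` is obtained from `D` by placing one auxiliary point, with the darts `u` and `v`, on the edge
with the darts `a` and `D.opp a`. -/
structure Subdivision (D E : VirtualDiagram) where
  emb : D.Dart → E.Dart
  reg : D.Region ≃ E.Region
  a : D.Dart
  u : E.Dart
  v : E.Dart
  bijective : Function.Bijective (Sum.elim emb ![u, v])
  rot_emb : ∀ d, E.rot (emb d) = emb (D.rot d)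
  rot_u : E.rot u = v
  rot_v : E.rot v = u
  opp_emb : ∀ d, d ≠ a → d ≠ D.opp a → E.opp (emb d) = emb (D.opp d)
  opp_u : E.opp u = emb a
  opp_v : E.opp v = emb (D.opp a)
  mark_emb : ∀ d, E.mark (emb d) = D.mark d
  mark_u : E.mark u = Mark.point
  region_emb : ∀ d, E.region (emb d) = reg (D.region d)
  outer_reg : reg D.outer = E.outer

/-- First move (classical or virtual): `E` is obtained from `D` by replacing an auxiliary point, with
the darts `x` and `y`, by a crossing with a small loop, whose edge has the darts `u` and `v`.  The
counterclockwise order at the new crossing is `x, u, v, y`, so that the strand runs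
`x, v, u, y`. -/
structure FirstMove (D E : VirtualDiagram) where
  emb : D.Dart → E.Dart
  reg : D.Region → E.Region
  x : D.Dart
  y : D.Dart
  u : E.Dart
  v : E.Dart
  bijective : Function.Bijective (Sum.elim emb ![u, v])
  mark_x : D.mark x = Mark.point
  rot_x : D.rot x = y
  opp_emb : ∀ d, E.opp (emb d) = emb (D.opp d)
  opp_u : E.opp u = v
  rot_emb : ∀ d, d ≠ x → d ≠ y → E.rot (emb d) = emb (D.rot d)
  rot_emb_x : E.rot (emb x) = u
  rot_u : E.rot u = v
  rot_v : E.rot v = emb y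
  rot_emb_y : E.rot (emb y) = emb x
  mark_emb : ∀ d, d ≠ x → d ≠ y → E.mark (emb d) = D.mark d
  /-- the regions of `E` are those of `D` and the inside of the loop -/
  bijective_reg : Function.Bijective (Sum.elim reg ![E.region u])
  region_emb : ∀ d, E.region (emb d) = reg (D.region d)
  outer_reg : reg D.outer = E.outer

/-- Second move (classical or virtual): in `D`, the strands through two auxiliary points, with the
darts `x, y` and `z, w`, face each other across a region, which is to the right of the first strand
(directed from `x` to `y`) and to the left of the second one (directed from `z` to `w`).  In `E`, the strands
overlap in a bigon and the two points are replaced by two crossings, with the counterclockwise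
orders `x, z, p, r` and `y, s, q, w`; the sides of the bigon are the edges `p, q` (on the strand of
`x, y`) and `r, s` (on the strand of `z, w`).

The picture, with north at the top: `x` is north-west, `y` is north-east, `z` is south-west and `w`
is south-east. -/
structure SecondMove (D E : VirtualDiagram) where
  emb : D.Dart → E.Dart
  reg : E.Region → D.Region
  x : D.Dart
  y : D.Dart
  z : D.Dart
  w : D.Dart
  p : E.Dart
  q : E.Dart
  r : E.Dart
  s : E.Dart
  bijective : Function.Bijective (Sum.elim emb ![p, q, r, s])
  x_ne_z : x ≠ z
  x_ne_w : x ≠ w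
  mark_x : D.mark x = Mark.point
  mark_z : D.mark z = Mark.point
  rot_x : D.rot x = y
  rot_z : D.rot z = w
  region_facing : D.region x = D.region w
  opp_emb : ∀ d, E.opp (emb d) = emb (D.opp d)
  opp_p : E.opp p = q
  opp_r : E.opp r = s
  rot_emb : ∀ d, d ≠ x → d ≠ y → d ≠ z → d ≠ w → E.rot (emb d) = emb (D.rot d)
  rot_emb_x : E.rot (emb x) = emb z
  rot_emb_z : E.rot (emb z) = p
  rot_p : E.rot p = r
  rot_r : E.rot r = emb x
  rot_emb_y : E.rot (emb y) = s
  rot_s : E.rot s = q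
  rot_q : E.rot q = emb w
  rot_emb_w : E.rot (emb w) = emb y
  mark_emb : ∀ d, d ≠ x → d ≠ y → d ≠ z → d ≠ w → E.mark (emb d) = D.mark d
  /-- both crossings are virtual, or one of the strands is above the other at both of them -/
  mark_emb_y : E.mark (emb y) = E.mark (emb x)
  /-- the bigon is a bounded region without further boundary; the other regions of `E` are those of
  `D`, except that the region between the strands is cut by the bigon into a western and an eastern
  part (which may still be the same region) -/
  outer_ne : E.outer ≠ E.region p
  region_emb_ne : ∀ d, E.region (emb d) ≠ E.region p
  region_emb : ∀ d, reg (E.region (emb d)) = D.region d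
  outer_reg : reg E.outer = D.outer
  reg_eq_iff : ∀ i j, i ≠ E.region p → j ≠ E.region p → (reg i = reg j ↔ i = j ∨
    (i = E.region (emb x) ∧ j = E.region (emb w)) ∨ (i = E.region (emb w) ∧ j = E.region (emb x)))

/-- Three crossings at the corners of a triangular region.  The crossing number `k` (modulo 3) has
the darts `a k, b k, p k, q k` in counterclockwise order, where `a k`, `b k` leave the triangle and
`p k`, `q k` are on its sides.  So the three strands run
`a k, p k, q (k + 1), b (k + 1)`. -/
structure Triangle (D : VirtualDiagram) (a b p q : Fin 3 → D.Dart) : Prop where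
  injective : Function.Injective (Sum.elim (Sum.elim a b) (Sum.elim p q))
  rot_a : ∀ k, D.rot (a k) = b k
  rot_b : ∀ k, D.rot (b k) = p k
  rot_p : ∀ k, D.rot (p k) = q k
  rot_q : ∀ k, D.rot (q k) = a k
  opp_p : ∀ k, D.opp (p k) = q (k + 1)
  /-- the triangle is a bounded region without further boundary -/
  outer_ne : D.outer ≠ D.region (p 0)
  region_eq : ∀ d, D.region d = D.region (p 0) → ∃ k, d = p k

/-- Third move (classical, virtual or mixed): three strands which cross pairwise in a disc are
replaced by three strands with the same ends in which the triangle is turned over.  The six ends are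
`a 0, b 0, a 1, b 1, a 2, b 2` in counterclockwise order; in `D` the crossings are next to the pairs
of ends `a k, b k`, and in `E` they are next to the pairs `b k, a (k + 1)`.

The levels of the strands are the same at corresponding crossings.  The allowed cases are: a strand
is virtual at both of its crossings and the third crossing is of any kind; or all the
three crossings are classical and some strand is above or below both of the others. -/
structure ThirdMove (D E : VirtualDiagram) where
  dart : D.Dart ≃ E.Dart
  reg : D.Region ≃ E.Region
  a : Fin 3 → D.Dart
  b : Fin 3 → D.Dart
  p : Fin 3 → D.Dart
  q : Fin 3 → D.Dart
  triangle : D.Triangle a b p q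
  triangle' : E.Triangle (fun k => dart (b k)) (fun k => dart (a (k + 1)))
    (fun k => dart (q k)) (fun k => dart (p (k + 1)))
  opp_dart : ∀ d, E.opp (dart d) = dart (D.opp d)
  rot_dart : ∀ d, (∀ k, d ≠ a k ∧ d ≠ b k ∧ d ≠ p k ∧ d ≠ q k) →
    E.rot (dart d) = dart (D.rot d)
  mark_dart : ∀ d, (∀ k, d ≠ a k ∧ d ≠ b k ∧ d ≠ p k ∧ d ≠ q k) →
    E.mark (dart d) = D.mark d
  mark_dart_a : ∀ k, E.mark (dart (a k)) = D.mark (b (k + 1))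
  mark_dart_b : ∀ k, E.mark (dart (b (k + 1))) = D.mark (a k)
  region_dart : ∀ d, (∀ k, d ≠ p k ∧ d ≠ q k) → E.region (dart d) = reg (D.region d)
  outer_reg : reg D.outer = E.outer
  levels : ∃ k, D.mark (a k) = D.mark (b (k + 1)) ∧
    (D.mark (a k) = Mark.virt ∨ D.mark (a (k + 2)) ≠ Mark.virt)

/-- Elementary planar isotopy, which does not change the crossings. -/
def Isotopy (D E : VirtualDiagram) : Prop :=
  Nonempty (Iso D E) ∨ Nonempty (Subdivision D E) ∨ Nonempty (Subdivision E D)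

/-- One generalized Reidemeister move, in either direction. -/
def ReidemeisterMove (D E : VirtualDiagram) : Prop :=
  Nonempty (FirstMove D E) ∨ Nonempty (FirstMove E D) ∨
  Nonempty (SecondMove D E) ∨ Nonempty (SecondMove E D) ∨
  Nonempty (ThirdMove D E) ∨ Nonempty (ThirdMove E D)

/-- One generalized Reidemeister move or an elementary planar isotopy. -/
def Step (D E : VirtualDiagram) : Prop := Isotopy D E ∨ ReidemeisterMove D E

/-- Equivalence of virtual diagrams by generalized Reidemeister moves. -/
def Equivalent (D E : VirtualDiagram) : Prop := Relation.ReflTransGen Step D E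

/-- The atom of the diagram is orientable. -/
def HasOrientableAtom (D : VirtualDiagram) : Prop := D.atom.Orientable

end VirtualDiagram

/-!
The proof is a version of the projection which makes the odd crossings of a diagram virtual, for a
parity that also makes sense for links.

Direct the edges of each curve so that the direction is reversed at each passage through a classical
crossing and nowhere else (`VirtualDiagram.Alternating`). A classical crossing is even if one of its
strands runs towards it on both sides and the other one away from it, and odd otherwise. The atom is
orientable exactly if there is such a direction without odd crossings (`Alternating.orientable`,
`HasOrientableAtom.exists_alternating`). Let `thin` be the operation which makes the odd classical
crossings virtual.

An alternating direction can be carried along each step, as only the edges inside of the disc of the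
move have to be adapted. The crossing of a first move is even, the two crossings of a second move
have the same parity, corresponding crossings of a third move have the same parity, and if all three
of these are classical, then none or two of them are odd. Hence thinning turns the step into a step
(`Step.exists_thin`).

Now let a sequence of steps begin at a diagram `D` with an orientable atom. Start with a direction
of `D` without odd crossings, carry it along the sequence and thin all diagrams. This does not
change `D`. If no crossing is odd, then all the atoms in the sequence are orientable; otherwise
repeat this with the thinned sequence, which has fewer classical crossings. So `D` is joined through
orientable atoms to a diagram obtained from the last one by making some classical crossings virtual
(`Chain.exists_reduct`).

For links, this need not be the last diagram `E` itself, even if its atom is orientable, as the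
direction carried along may differ from the one without odd crossings on some of the components.
Therefore the argument is applied from both ends: `D` is joined to a reduct of `E` and `E` to a
reduct of `D`. If the former is not `E`, then the two reducts, which are again equivalent and have
orientable atoms, have fewer classical crossings in total, and are joined by induction
(`Equivalent.reflTransGen_orientableStep`).
-/

/-! ### Alternating directions and thinning -/

/-- A crossing at which one strand is chosen as the overpass. -/
def Mark.IsClassical (m : Mark) : Prop := m = Mark.over ∨ m = Mark.under

/-- A mark after thinning: at an odd node (`odd` is true) a classical crossing becomes virtual. -/
def Mark.thin (odd : Bool) : Mark → Mark
  | .point => .point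
  | .virt => .virt
  | .over => if odd then .virt else .over
  | .under => if odd then .virt else .under

/-- The value of an alternating direction at the opposite dart of a crossing, given the value at a
dart: passing straight through, the direction is kept at a virtual crossing, so that the
value (towards or away from the node) changes, while it is reversed at a classical crossing. -/
def Mark.pass : Mark → Bool → Bool
  | .point, b => b
  | .virt, b => !b
  | .over, b => b
  | .under, b => b

@[simp]
theorem Mark.pass_next (m : Mark) : m.next.pass = m.pass := by cases m <;> rfl

@[simp]
theorem Mark.pass_pass (m : Mark) (b : Bool) : m.pass (m.pass b) = b := by
  cases m <;> simp [Mark.pass]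

@[simp]
theorem Mark.pass_not (m : Mark) (b : Bool) : m.pass (!b) = !m.pass b := by
  cases m <;> simp [Mark.pass]

@[simp]
theorem Mark.pass_inj (m : Mark) (b c : Bool) : m.pass b = m.pass c ↔ b = c := by
  cases m <;> simp [Mark.pass]

@[simp]
theorem Mark.next_eq_point (m : Mark) : m.next = .point ↔ m = .point := by
  cases m <;> simp [Mark.next]

namespace VirtualDiagram

/-- A choice, on each curve, of a direction of its edges which is reversed at each passage through a
classical crossing and nowhere else.  The value `s d` tells whether the edge of `d` is directed
towards the node of `d`. -/
structure Alternating (D : VirtualDiagram) (s : D.Dart → Bool) : Prop where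
  opp : ∀ d, s (D.opp d) = !s d
  point : ∀ d, D.mark d = Mark.point → s (D.rot d) = !s d
  crossing : ∀ d, D.mark d ≠ Mark.point → s (D.rot (D.rot d)) = (D.mark d).pass (s d)

/-- The diagram in which each odd classical crossing, that is, each one at which
neighbouring darts have the same value of `s`, is replaced by a virtual crossing. -/
def thin (D : VirtualDiagram) (s : D.Dart → Bool) (h : D.Alternating s) : VirtualDiagram where
  __ := D
  mark d := Mark.thin (s d == s (D.rot d)) (D.mark d)
  rot_point d hd := D.rot_point d (by
    rcases hm : D.mark d <;> simp_all [Mark.thin] <;> split at hd <;> simp_all)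
  rot_crossing d hd := D.rot_crossing d (by
    rintro hm
    simp [hm, Mark.thin] at hd)
  mark_rot d := by
    have h1 := D.mark_rot d
    have h2 := h.crossing d
    rcases hm : D.mark d <;> simp_all [Mark.thin, Mark.next, Mark.pass] <;>
      cases s d <;> cases s (D.rot d) <;> rfl

@[simp]
theorem thin_mark (D : VirtualDiagram) (s : D.Dart → Bool) (h : D.Alternating s) (d : D.Dart) :
    (D.thin s h).mark d = Mark.thin (s d == s (D.rot d)) (D.mark d) := rfl

/-- An alternating direction without odd classical crossings is a source-sink structure, and
orients the cells of the atom. -/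
theorem Alternating.orientable {D : VirtualDiagram} {s : D.Dart → Bool} (h : D.Alternating s)
    (he : ∀ d, (D.mark d).IsClassical → s (D.rot d) = !s d) : D.HasOrientableAtom := by
  have he' : ∀ d, (D.mark d).IsClassical → s (D.rot.symm d) = !s d := by
    intro d hd
    have := he (D.rot.symm d) (by
      rw [D.mark_rot_symm]
      rcases hd with hd | hd <;> rw [hd] <;> simp [Mark.next, Mark.IsClassical])
    rw [Equiv.apply_symm_apply] at this
    simp [this]
  refine ⟨fun c d => if c then s d else !s d, ?_, ?_, ?_⟩
  · intro c d
    have := h.opp d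
    cases c <;> simp_all [atom]
  · intro c d
    have h1 := he d
    have h2 := he' d
    have h3 := h.point d
    have h4 := h.crossing d
    rcases hm : D.mark d <;> cases c <;> simp_all [atom, atomCorner, Mark.IsClassical, Mark.pass]
  · intro d; simp

theorem HasOrientableAtom.exists_alternating {D : VirtualDiagram} (hD : D.HasOrientableAtom) :
    ∃ s, D.Alternating s ∧ ∀ d, (D.mark d).IsClassical → s (D.rot d) = !s d := by
  obtain ⟨dir, h1, h2, h3⟩ := hD
  have key : ∀ d, (D.mark d).IsClassical → dir true (D.rot d) = !dir true d := by
    intro d hd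
    have a := h2 true d
    have b := h2 false d
    simp only [h3] at b
    rcases hd with hd | hd <;> simp_all [atom, atomCorner]
  have key2 : ∀ d, (D.mark d).IsClassical → dir true (D.rot (D.rot d)) = dir true d := by
    intro d hd
    have := key (D.rot d) (by
      rw [D.mark_rot]; rcases hd with hd | hd <;> rw [hd] <;> simp [Mark.next, Mark.IsClassical])
    rw [this, key d hd]; simp
  refine ⟨dir true, ⟨h1 true, ?_, ?_⟩, key⟩
  · intro d hd
    have := h2 true d
    simpa [atom, atomCorner, hd] using this
  · intro d hd
    have h4 := h2 true d
    have h5 := key2 d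
    rcases hm : D.mark d <;> simp_all [atom, atomCorner, Mark.pass, Mark.IsClassical]

theorem thin_eq_self {D : VirtualDiagram} {s : D.Dart → Bool} (h : D.Alternating s)
    (he : ∀ d, (D.mark d).IsClassical → s (D.rot d) = !s d) : D.thin s h = D := by
  have : (fun d => Mark.thin (s d == s (D.rot d)) (D.mark d)) = D.mark := by
    funext d
    have := he d
    rcases hm : D.mark d <;> simp_all [Mark.thin, Mark.IsClassical]
  cases D
  simp only [thin] at this ⊢
  congr

/-- The number of darts at classical crossings. -/
noncomputable def classicalCount (D : VirtualDiagram) : ℕ :=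
  Nat.card {d : D.Dart // (D.mark d).IsClassical}

theorem isClassical_of_thin {D : VirtualDiagram} {s : D.Dart → Bool} {h : D.Alternating s}
    {d : D.Dart} (hd : ((D.thin s h).mark d).IsClassical) :
    (D.mark d).IsClassical ∧ s (D.rot d) = !s d := by
  rcases hm : D.mark d <;> cases h1 : s d <;> cases h2 : s (D.rot d) <;>
    simp_all [Mark.thin, Mark.IsClassical]

theorem classicalCount_thin_le {D : VirtualDiagram} {s : D.Dart → Bool} (h : D.Alternating s) :
    (D.thin s h).classicalCount ≤ D.classicalCount := by
  have := D.finite_dart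
  exact Nat.card_le_card_of_injective
    (fun d : {d // ((D.thin s h).mark d).IsClassical} =>
      (⟨d.1, (isClassical_of_thin d.2).1⟩ : {d : D.Dart // (D.mark d).IsClassical}))
    (fun a b hab => Subtype.ext (congrArg (fun z => z.1) hab))

theorem even_of_classicalCount_eq {D : VirtualDiagram} {s : D.Dart → Bool} (h : D.Alternating s)
    (hc : (D.thin s h).classicalCount = D.classicalCount) :
    ∀ d, (D.mark d).IsClassical → s (D.rot d) = !s d := by
  have := D.finite_dart
  let f : {d // ((D.thin s h).mark d).IsClassical} → {d : D.Dart // (D.mark d).IsClassical} :=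
    fun d => ⟨d.1, (isClassical_of_thin d.2).1⟩
  have hf : Function.Injective f := fun a b hab => Subtype.ext (congrArg (fun z => z.1) hab)
  have : Finite {d // ((D.thin s h).mark d).IsClassical} := Finite.of_injective f hf
  have hb := (Nat.bijective_iff_injective_and_card f).2 ⟨hf, hc⟩
  intro d hd
  obtain ⟨e, he⟩ := hb.2 ⟨d, hd⟩
  obtain rfl : e.1 = d := congrArg Subtype.val he
  exact (isClassical_of_thin e.2).2

/-! ### Thinning of isotopies and of first and second moves -/

section
variable {D E : VirtualDiagram} {s : D.Dart → Bool} {t : E.Dart → Bool}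

theorem Alternating.thin_mark_eq_point_iff (h : D.Alternating s) (d : D.Dart) :
    (D.thin s h).mark d = Mark.point ↔ D.mark d = Mark.point := by
  rw [thin_mark]
  cases D.mark d <;> cases s d == s (D.rot d) <;> simp [Mark.thin]

theorem thin_mark_congr (h : D.Alternating s) (k : E.Alternating t) {d : D.Dart} {e : E.Dart}
    (hm : E.mark e = D.mark d) (h0 : t e = s d) (h1 : t (E.rot e) = s (D.rot d)) :
    (E.thin t k).mark e = (D.thin s h).mark d := by
  rw [thin_mark, thin_mark, hm, h0, h1]

/-- A function on the old darts extends to all darts, with given values on the new ones. -/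
theorem exists_extension {α β : Type} {n : ℕ} {emb : α → β} {v : Fin n → β}
    (hb : Function.Bijective (Sum.elim emb v)) (s : α → Bool) (w : Fin n → Bool) :
    ∃ t : β → Bool, (∀ a, t (emb a) = s a) ∧ ∀ i, t (v i) = w i := by
  refine ⟨Sum.elim s w ∘ (Equiv.ofBijective _ hb).symm, fun a => ?_, fun i => ?_⟩
  · exact congrArg (Sum.elim s w) ((Equiv.ofBijective _ hb).symm_apply_apply (Sum.inl a))
  · exact congrArg (Sum.elim s w) ((Equiv.ofBijective _ hb).symm_apply_apply (Sum.inr i))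

theorem Iso.alternating (f : Iso D E) (h : D.Alternating s) :
    E.Alternating (s ∘ f.dart.symm) := by
  have hr : ∀ e, f.dart.symm (E.rot e) = D.rot (f.dart.symm e) := fun e => by
    rw [Equiv.symm_apply_eq, ← f.rot_dart, Equiv.apply_symm_apply]
  have ho : ∀ e, f.dart.symm (E.opp e) = D.opp (f.dart.symm e) := fun e => by
    rw [Equiv.symm_apply_eq, ← f.opp_dart, Equiv.apply_symm_apply]
  have hm : ∀ e, E.mark e = D.mark (f.dart.symm e) := fun e => by
    rw [← f.mark_dart, Equiv.apply_symm_apply]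
  constructor <;> intro e <;> simp only [Function.comp, hr, ho, hm]
  · exact h.opp _
  · exact h.point _
  · exact h.crossing _

/-- Thinning of an isomorphism. -/
def Iso.thin (f : Iso D E) (h : D.Alternating s) (k : E.Alternating t)
    (ht : ∀ d, t (f.dart d) = s d) : Iso (D.thin s h) (E.thin t k) where
  __ := f
  mark_dart d := thin_mark_congr h k (f.mark_dart d) (ht d)
    ((congrArg t (f.rot_dart d)).trans (ht _))

/-- Thinning of a subdivision, for alternating directions which agree outside of the new point. -/
def Subdivision.thin (f : Subdivision D E) (h : D.Alternating s) (k : E.Alternating t)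
    (ht : ∀ d, t (f.emb d) = s d) : Subdivision (D.thin s h) (E.thin t k) where
  __ := f
  mark_emb d := thin_mark_congr h k (f.mark_emb d) (ht d) ((congrArg t (f.rot_emb d)).trans (ht _))
  mark_u := (k.thin_mark_eq_point_iff _).2 f.mark_u

theorem Subdivision.exists_alternating (f : Subdivision D E) (h : D.Alternating s) :
    ∃ t, E.Alternating t ∧ ∀ d, t (f.emb d) = s d := by
  obtain ⟨t, ht, hw⟩ := exists_extension f.bijective s ![!s f.a, s f.a]
  have hu : t f.u = !s f.a := hw 0
  have hv : t f.v = s f.a := hw 1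
  have hcase : ∀ P : E.Dart → Prop, (∀ d, P (f.emb d)) → P f.u → P f.v → ∀ e, P e := by
    intro P h1 h2 h3 e
    obtain ⟨d | i, rfl⟩ := f.bijective.2 e
    · exact h1 d
    · fin_cases i <;> assumption
  have hmv : E.mark f.v = Mark.point := by rw [← f.rot_u, E.mark_rot, f.mark_u]; rfl
  have hmu := f.mark_u
  refine ⟨t, ⟨?_, ?_, ?_⟩, ht⟩ <;> refine hcase _ ?_ ?_ ?_
  · intro d
    by_cases h1 : d = f.a
    · rw [h1, ← f.opp_u, E.opp_opp, f.opp_u, ht, hu]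
    by_cases h2 : d = D.opp f.a
    · rw [h2, ← f.opp_v, E.opp_opp, f.opp_v, ht, hv, h.opp]; simp
    · rw [f.opp_emb d h1 h2, ht, ht, h.opp]
  · rw [f.opp_u, ht, hu]; simp
  · rw [f.opp_v, ht, hv, h.opp]
  · intro d; rw [f.mark_emb, f.rot_emb, ht, ht]; exact h.point d
  · rw [f.rot_u, hu, hv]; simp
  · rw [f.rot_v, hu, hv]; simp
  · intro d; rw [f.mark_emb, f.rot_emb, f.rot_emb, ht, ht]; exact h.crossing d
  · simp [hmu]
  · simp [hmv]

theorem Subdivision.alternating (f : Subdivision D E) (k : E.Alternating t) :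
    D.Alternating (t ∘ f.emb) := by
  constructor <;> intro d <;> simp only [Function.comp]
  · have hu := k.point f.u f.mark_u
    have h1 := k.opp f.u
    have h2 := k.opp f.v
    rw [f.rot_u] at hu
    rw [f.opp_u] at h1
    rw [f.opp_v] at h2
    by_cases h3 : d = f.a
    · simp_all
    by_cases h4 : d = D.opp f.a
    · rw [h4, D.opp_opp]; simp_all
    · rw [← f.opp_emb d h3 h4, k.opp]
  · rw [← f.rot_emb, ← f.mark_emb]; exact k.point _
  · rw [← f.rot_emb, ← f.rot_emb, ← f.mark_emb]; exact k.crossing _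

/-- Thinning of a first move, for alternating directions which agree outside of the new loop. -/
def FirstMove.thin (f : FirstMove D E) (h : D.Alternating s) (k : E.Alternating t)
    (ht : ∀ d, t (f.emb d) = s d) : FirstMove (D.thin s h) (E.thin t k) where
  __ := f
  mark_x := (h.thin_mark_eq_point_iff _).2 f.mark_x
  mark_emb d hx hy :=
    thin_mark_congr h k (f.mark_emb d hx hy) (ht d) ((congrArg t (f.rot_emb d hx hy)).trans (ht _))

theorem FirstMove.rot_y (f : FirstMove D E) : D.rot f.y = f.x := by
  rw [← f.rot_x]; exact D.rot_point _ f.mark_x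

theorem FirstMove.mark_emb_x_ne (f : FirstMove D E) : E.mark (f.emb f.x) ≠ Mark.point := by
  intro hm
  have h := E.rot_point _ hm
  rw [f.rot_emb_x, f.rot_u] at h
  exact absurd (f.bijective.1 (a₁ := Sum.inr 1) (a₂ := Sum.inl f.x) h) (by simp)

/-- To prove a statement for all darts after a first move, the four darts of the new crossing
may be treated apart. -/
theorem FirstMove.dart_cases (f : FirstMove D E) {P : E.Dart → Prop}
    (h : ∀ d, d ≠ f.x → d ≠ f.y → P (f.emb d)) (hx : P (f.emb f.x)) (hy : P (f.emb f.y))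
    (hu : P f.u) (hv : P f.v) (e : E.Dart) : P e := by
  obtain ⟨d | i, rfl⟩ := f.bijective.2 e
  · by_cases h1 : d = f.x
    · subst h1; exact hx
    by_cases h2 : d = f.y
    · subst h2; exact hy
    exact h d h1 h2
  · fin_cases i <;> assumption

theorem FirstMove.mark_u (f : FirstMove D E) : E.mark f.u = (E.mark (f.emb f.x)).next := by
  rw [← E.mark_rot, f.rot_emb_x]

theorem FirstMove.mark_v (f : FirstMove D E) : E.mark f.v = (E.mark (f.emb f.x)).next.next := by
  rw [← f.mark_u, ← E.mark_rot, f.rot_u]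

theorem FirstMove.mark_emb_y (f : FirstMove D E) :
    E.mark (f.emb f.y) = (E.mark (f.emb f.x)).next.next.next := by
  rw [← f.mark_v, ← E.mark_rot, f.rot_v]

theorem FirstMove.rot_ne_x (f : FirstMove D E) {d : D.Dart} (hd : d ≠ f.y) : D.rot d ≠ f.x :=
  fun he => hd (D.rot.injective (he.trans f.rot_y.symm))

theorem FirstMove.rot_ne_y (f : FirstMove D E) {d : D.Dart} (hd : d ≠ f.x) : D.rot d ≠ f.y :=
  fun he => hd (D.rot.injective (he.trans f.rot_x.symm))

theorem FirstMove.exists_alternating (f : FirstMove D E) (h : D.Alternating s) :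
    ∃ t, E.Alternating t ∧ ∀ d, t (f.emb d) = s d := by
  obtain ⟨t, ht, ht'⟩ := exists_extension f.bijective s
    ![!(E.mark (f.emb f.x)).pass (s f.x), (E.mark (f.emb f.x)).pass (s f.x)]
  have hu : t f.u = !(E.mark (f.emb f.x)).pass (s f.x) := ht' 0
  have hv : t f.v = (E.mark (f.emb f.x)).pass (s f.x) := ht' 1
  have hy : s f.y = !s f.x := by rw [← f.rot_x]; exact h.point _ f.mark_x
  have hm := f.mark_emb_x_ne
  have ho : E.opp f.v = f.u := by rw [← f.opp_u, E.opp_opp]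
  refine ⟨t, ⟨?_, ?_, ?_⟩, ht⟩
  · refine f.dart_cases (fun d _ _ => ?_) ?_ ?_ ?_ ?_
    · rw [f.opp_emb, ht, ht, h.opp]
    · rw [f.opp_emb, ht, ht, h.opp]
    · rw [f.opp_emb, ht, ht, h.opp]
    · rw [f.opp_u, hu, hv]; simp
    · rw [ho, hu, hv]
  · refine f.dart_cases (fun d hx hy => ?_) ?_ ?_ ?_ ?_
    · rw [f.mark_emb d hx hy, f.rot_emb d hx hy, ht, ht]; exact h.point d
    · simp [hm]
    · simp [f.mark_emb_y, hm]
    · simp [f.mark_u, hm]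
    · simp [f.mark_v, hm]
  · refine f.dart_cases (fun d hx hy => ?_) ?_ ?_ ?_ ?_
    · rw [f.mark_emb d hx hy, f.rot_emb d hx hy, f.rot_emb _ (f.rot_ne_x hy) (f.rot_ne_y hx),
        ht, ht]
      exact h.crossing d
    · simp [f.rot_emb_x, f.rot_u, hv, ht]
    · simp [f.rot_emb_y, f.rot_emb_x, f.mark_emb_y, hu, ht, hy]
    · simp [f.rot_u, f.rot_v, f.mark_u, hu, ht, hy]
    · simp [f.rot_v, f.rot_emb_y, f.mark_v, hv, ht]

theorem FirstMove.alternating (f : FirstMove D E) (k : E.Alternating t) :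
    D.Alternating (t ∘ f.emb) := by
  have hm := f.mark_emb_x_ne
  have hy : t (f.emb f.y) = !t (f.emb f.x) := by
    have h1 := k.crossing (f.emb f.x) hm
    have h2 := k.crossing f.u (by simp [f.mark_u, hm])
    have h3 := k.opp f.u
    rw [f.rot_emb_x, f.rot_u] at h1
    rw [f.rot_u, f.rot_v, f.mark_u] at h2
    rw [f.opp_u, h1] at h3
    rw [h2, Mark.pass_next, ← Bool.not_not (t f.u), ← h3]
    simp
  have hmy : D.mark f.y = Mark.point := by rw [← f.rot_x, D.mark_rot, f.mark_x]; rfl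
  refine ⟨fun d => ?_, fun d hd => ?_, fun d hd => ?_⟩ <;> simp only [Function.comp]
  · rw [← f.opp_emb, k.opp]
  · by_cases h1 : d = f.x
    · rw [h1, f.rot_x, hy]
    by_cases h2 : d = f.y
    · rw [h2, f.rot_y, hy]; simp
    rw [← f.rot_emb d h1 h2]
    exact k.point _ ((f.mark_emb d h1 h2).trans hd)
  · have h1 : d ≠ f.x := by rintro rfl; exact hd f.mark_x
    have h2 : d ≠ f.y := by rintro rfl; exact hd hmy
    rw [← f.rot_emb _ (f.rot_ne_x h2) (f.rot_ne_y h1), ← f.rot_emb d h1 h2, ← f.mark_emb d h1 h2]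
    exact k.crossing _ (by rwa [f.mark_emb d h1 h2])

end
/-! ### Thinning of second moves -/

section
variable {D E : VirtualDiagram} {s : D.Dart → Bool} {t : E.Dart → Bool}

namespace SecondMove

theorem rot_y (f : SecondMove D E) : D.rot f.y = f.x := by
  rw [← f.rot_x]; exact D.rot_point _ f.mark_x

theorem rot_w (f : SecondMove D E) : D.rot f.w = f.z := by
  rw [← f.rot_z]; exact D.rot_point _ f.mark_z

theorem mark_y (f : SecondMove D E) : D.mark f.y = Mark.point := by
  rw [← f.rot_x, D.mark_rot, f.mark_x]; rfl

theorem mark_w (f : SecondMove D E) : D.mark f.w = Mark.point := by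
  rw [← f.rot_z, D.mark_rot, f.mark_z]; rfl

theorem mark_emb_x_ne (f : SecondMove D E) : E.mark (f.emb f.x) ≠ Mark.point := by
  intro hm
  have h := E.rot_point _ hm
  rw [f.rot_emb_x, f.rot_emb_z] at h
  exact absurd (f.bijective.1 (a₁ := Sum.inr 0) (a₂ := Sum.inl f.x) h) (by simp)

/-- To prove a statement for all darts after a second move, the eight darts of the new crossings
may be treated apart. -/
theorem dart_cases (f : SecondMove D E) {P : E.Dart → Prop}
    (h : ∀ d, d ≠ f.x → d ≠ f.y → d ≠ f.z → d ≠ f.w → P (f.emb d))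
    (hx : P (f.emb f.x)) (hy : P (f.emb f.y)) (hz : P (f.emb f.z)) (hw : P (f.emb f.w))
    (hp : P f.p) (hq : P f.q) (hr : P f.r) (hs : P f.s) (e : E.Dart) : P e := by
  obtain ⟨d | i, rfl⟩ := f.bijective.2 e
  · by_cases h1 : d = f.x
    · subst h1; exact hx
    by_cases h2 : d = f.y
    · subst h2; exact hy
    by_cases h3 : d = f.z
    · subst h3; exact hz
    by_cases h4 : d = f.w
    · subst h4; exact hw
    exact h d h1 h2 h3 h4
  · fin_cases i <;> assumption

theorem mark_emb_z (f : SecondMove D E) :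
    E.mark (f.emb f.z) = (E.mark (f.emb f.x)).next := by
  rw [← E.mark_rot, f.rot_emb_x]

theorem mark_p (f : SecondMove D E) : E.mark f.p = (E.mark (f.emb f.x)).next.next := by
  rw [← f.mark_emb_z, ← E.mark_rot, f.rot_emb_z]

theorem mark_r (f : SecondMove D E) : E.mark f.r = (E.mark (f.emb f.x)).next.next.next := by
  rw [← f.mark_p, ← E.mark_rot, f.rot_p]

theorem mark_s (f : SecondMove D E) : E.mark f.s = (E.mark (f.emb f.x)).next := by
  rw [← f.mark_emb_y, ← E.mark_rot, f.rot_emb_y]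

theorem mark_q (f : SecondMove D E) : E.mark f.q = (E.mark (f.emb f.x)).next.next := by
  rw [← f.mark_s, ← E.mark_rot, f.rot_s]

theorem mark_emb_w (f : SecondMove D E) :
    E.mark (f.emb f.w) = (E.mark (f.emb f.x)).next.next.next := by
  rw [← f.mark_q, ← E.mark_rot, f.rot_q]

theorem rot_ne (f : SecondMove D E) {d : D.Dart} (hx : d ≠ f.x) (hy : d ≠ f.y) (hz : d ≠ f.z)
    (hw : d ≠ f.w) : D.rot d ≠ f.x ∧ D.rot d ≠ f.y ∧ D.rot d ≠ f.z ∧ D.rot d ≠ f.w :=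
  ⟨fun he => hy (D.rot.injective (he.trans f.rot_y.symm)),
    fun he => hx (D.rot.injective (he.trans f.rot_x.symm)),
    fun he => hw (D.rot.injective (he.trans f.rot_w.symm)),
    fun he => hz (D.rot.injective (he.trans f.rot_z.symm))⟩

theorem alternating_p (f : SecondMove D E) (k : E.Alternating t) :
    t f.p = (E.mark (f.emb f.x)).pass (t (f.emb f.x)) := by
  have h := k.crossing _ f.mark_emb_x_ne
  rwa [f.rot_emb_x, f.rot_emb_z] at h

theorem alternating_r (f : SecondMove D E) (k : E.Alternating t) :
    t f.r = (E.mark (f.emb f.x)).pass (t (f.emb f.z)) := by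
  have h := k.crossing (f.emb f.z) (by simp [f.mark_emb_z, f.mark_emb_x_ne])
  rwa [f.rot_emb_z, f.rot_p, f.mark_emb_z, Mark.pass_next] at h

theorem alternating_q (f : SecondMove D E) (k : E.Alternating t) :
    t f.q = (E.mark (f.emb f.x)).pass (t (f.emb f.y)) := by
  have h := k.crossing (f.emb f.y) (by simp [f.mark_emb_y, f.mark_emb_x_ne])
  rwa [f.rot_emb_y, f.rot_s, f.mark_emb_y] at h

theorem alternating_s (f : SecondMove D E) (k : E.Alternating t) :
    t (f.emb f.w) = (E.mark (f.emb f.x)).pass (t f.s) := by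
  have h := k.crossing f.s (by simp [f.mark_s, f.mark_emb_x_ne])
  rwa [f.rot_s, f.rot_q, f.mark_s, Mark.pass_next] at h

theorem alternating_emb_y (f : SecondMove D E) (k : E.Alternating t) :
    t (f.emb f.y) = !t (f.emb f.x) := by
  have h := k.opp f.p
  rw [f.opp_p, f.alternating_p k, f.alternating_q k, ← Mark.pass_not, Mark.pass_inj] at h
  exact h

theorem alternating_emb_w (f : SecondMove D E) (k : E.Alternating t) :
    t (f.emb f.w) = !t (f.emb f.z) := by
  have h := k.opp f.r
  rw [f.opp_r, f.alternating_r k] at h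
  rw [f.alternating_s k, h]
  simp

/-- Thinning of a second move, for alternating directions which agree outside of the bigon. -/
def thin (f : SecondMove D E) (h : D.Alternating s) (k : E.Alternating t)
    (ht : ∀ d, t (f.emb d) = s d) : SecondMove (D.thin s h) (E.thin t k) where
  __ := f
  mark_x := (h.thin_mark_eq_point_iff _).2 f.mark_x
  mark_z := (h.thin_mark_eq_point_iff _).2 f.mark_z
  mark_emb d hx hy hz hw := thin_mark_congr h k (f.mark_emb d hx hy hz hw) (ht d)
    ((congrArg t (f.rot_emb d hx hy hz hw)).trans (ht _))
  mark_emb_y := by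
    -- Both strands are reversed in the same way between the crossings, so that these have the
    -- same parity if they are classical.
    have h1 := f.alternating_s k
    have h2 := f.alternating_emb_w k
    rw [thin_mark, thin_mark, f.rot_emb_x, f.rot_emb_y, f.mark_emb_y, f.alternating_emb_y k]
    rw [h1] at h2
    rcases hm : E.mark (f.emb f.x) <;> simp_all [Mark.thin, Mark.pass]

theorem exists_alternating (f : SecondMove D E) (h : D.Alternating s) :
    ∃ t, E.Alternating t ∧ ∀ d, t (f.emb d) = s d := by
  obtain ⟨m, hm⟩ : ∃ m, m = E.mark (f.emb f.x) := ⟨_, rfl⟩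
  obtain ⟨t, ht, ht'⟩ := exists_extension f.bijective s
    ![m.pass (s f.x), !m.pass (s f.x), m.pass (s f.z), !m.pass (s f.z)]
  have hp : t f.p = m.pass (s f.x) := ht' 0
  have hq : t f.q = !m.pass (s f.x) := ht' 1
  have hr : t f.r = m.pass (s f.z) := ht' 2
  have hs : t f.s = !m.pass (s f.z) := ht' 3
  have hy : s f.y = !s f.x := by rw [← f.rot_x]; exact h.point _ f.mark_x
  have hw : s f.w = !s f.z := by rw [← f.rot_z]; exact h.point _ f.mark_z
  have hne := f.mark_emb_x_ne
  have hoq : E.opp f.q = f.p := by rw [← f.opp_p, E.opp_opp]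
  have hos : E.opp f.s = f.r := by rw [← f.opp_r, E.opp_opp]
  have ho : ∀ d, t (E.opp (f.emb d)) = !t (f.emb d) := fun d => by
    rw [f.opp_emb, ht, ht, h.opp]
  refine ⟨t, ⟨?_, ?_, ?_⟩, ht⟩
  · refine f.dart_cases (fun d _ _ _ _ => ho d) (ho _) (ho _) (ho _) (ho _) ?_ ?_ ?_ ?_
    · rw [f.opp_p, hp, hq]
    · rw [hoq, hp, hq]; simp
    · rw [f.opp_r, hr, hs]
    · rw [hos, hr, hs]; simp
  · refine f.dart_cases (fun d hx hy hz hw => ?_) ?_ ?_ ?_ ?_ ?_ ?_ ?_ ?_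
    · rw [f.mark_emb d hx hy hz hw, f.rot_emb d hx hy hz hw, ht, ht]; exact h.point d
    all_goals
      simp [f.mark_emb_y, f.mark_emb_z, f.mark_emb_w, f.mark_p, f.mark_q, f.mark_r, f.mark_s, hne]
  · refine f.dart_cases (fun d hx hy hz hw => ?_) ?_ ?_ ?_ ?_ ?_ ?_ ?_ ?_
    · obtain ⟨h1, h2, h3, h4⟩ := f.rot_ne hx hy hz hw
      rw [f.mark_emb d hx hy hz hw, f.rot_emb d hx hy hz hw, f.rot_emb _ h1 h2 h3 h4, ht, ht]
      exact h.crossing d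
    all_goals
      simp [f.mark_emb_y, f.mark_emb_z, f.mark_emb_w, f.mark_p, f.mark_q, f.mark_r, f.mark_s,
        f.rot_emb_x, f.rot_emb_y, f.rot_emb_z, f.rot_emb_w, f.rot_p, f.rot_q, f.rot_r, f.rot_s,
        ht, hp, hq, hr, hs, hy, hw, ← hm]

theorem alternating (f : SecondMove D E) (k : E.Alternating t) : D.Alternating (t ∘ f.emb) := by
  have hy := f.alternating_emb_y k
  have hw := f.alternating_emb_w k
  refine ⟨fun d => ?_, fun d hd => ?_, fun d hd => ?_⟩ <;> simp only [Function.comp]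
  · rw [← f.opp_emb, k.opp]
  · by_cases h1 : d = f.x
    · rw [h1, f.rot_x, hy]
    by_cases h2 : d = f.y
    · rw [h2, f.rot_y, hy]; simp
    by_cases h3 : d = f.z
    · rw [h3, f.rot_z, hw]
    by_cases h4 : d = f.w
    · rw [h4, f.rot_w, hw]; simp
    rw [← f.rot_emb d h1 h2 h3 h4]
    exact k.point _ ((f.mark_emb d h1 h2 h3 h4).trans hd)
  · have hx : d ≠ f.x := by rintro rfl; exact hd f.mark_x
    have hy : d ≠ f.y := by rintro rfl; exact hd f.mark_y
    have hz : d ≠ f.z := by rintro rfl; exact hd f.mark_z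
    have hw : d ≠ f.w := by rintro rfl; exact hd f.mark_w
    obtain ⟨h1, h2, h3, h4⟩ := f.rot_ne hx hy hz hw
    rw [← f.rot_emb _ h1 h2 h3 h4, ← f.rot_emb d hx hy hz hw, ← f.mark_emb d hx hy hz hw]
    exact k.crossing _ (by rwa [f.mark_emb d hx hy hz hw])

end SecondMove

end
end VirtualDiagram

@[simp]
theorem Mark.pass_conj (m n : Mark) (b : Bool) :
    m.pass (n.pass (m.pass b)) = n.pass b := by
  cases m <;> cases n <;> simp [Mark.pass]

theorem fin_three_cases (i j : Fin 3) : i = j ∨ i = j + 1 ∨ i = j + 2 := by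
  revert i j; decide

theorem fin_three_add_one_two (k : Fin 3) : k + 1 + 2 = k := by revert k; decide

theorem fin_three_add_two_one (k : Fin 3) : k + 2 + 1 = k := by revert k; decide

theorem fin_three_add_two_two (k : Fin 3) : k + 2 + 2 = k + 1 := by revert k; decide

theorem fin_three_add_one_one (k : Fin 3) : k + 1 + 1 = k + 2 := by revert k; decide

namespace VirtualDiagram

/-! ### Thinning of third moves -/

section
variable {D E : VirtualDiagram} {s : D.Dart → Bool} {t : E.Dart → Bool}

namespace Triangle

variable {a b p q : Fin 3 → D.Dart}

theorem mark_b (T : D.Triangle a b p q) (k : Fin 3) : D.mark (b k) = (D.mark (a k)).next := by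
  rw [← D.mark_rot, T.rot_a]

theorem mark_p (T : D.Triangle a b p q) (k : Fin 3) :
    D.mark (p k) = (D.mark (a k)).next.next := by
  rw [← T.mark_b, ← D.mark_rot, T.rot_b]

theorem mark_q (T : D.Triangle a b p q) (k : Fin 3) :
    D.mark (q k) = (D.mark (a k)).next.next.next := by
  rw [← T.mark_p, ← D.mark_rot, T.rot_p]

theorem a_ne_side (T : D.Triangle a b p q) (k j : Fin 3) : a k ≠ p j ∧ a k ≠ q j :=
  ⟨fun he => by simpa using T.injective (a₁ := .inl (.inl k)) (a₂ := .inr (.inl j)) he,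
    fun he => by simpa using T.injective (a₁ := .inl (.inl k)) (a₂ := .inr (.inr j)) he⟩

theorem b_ne_side (T : D.Triangle a b p q) (k j : Fin 3) : b k ≠ p j ∧ b k ≠ q j :=
  ⟨fun he => by simpa using T.injective (a₁ := .inl (.inr k)) (a₂ := .inr (.inl j)) he,
    fun he => by simpa using T.injective (a₁ := .inl (.inr k)) (a₂ := .inr (.inr j)) he⟩

theorem mark_a_ne (T : D.Triangle a b p q) (k : Fin 3) : D.mark (a k) ≠ Mark.point := by
  intro hm
  have h := D.rot_point _ hm
  rw [T.rot_a, T.rot_b] at h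
  exact (T.a_ne_side k k).1 h.symm

theorem opp_q (T : D.Triangle a b p q) (k : Fin 3) : D.opp (q (k + 1)) = p k := by
  rw [← T.opp_p, D.opp_opp]

theorem region_p (T : D.Triangle a b p q) (k : Fin 3) :
    D.region (p (k + 1)) = D.region (p k) := by
  rw [← D.region_opp (p k), T.opp_p, ← T.rot_p, Equiv.symm_apply_apply]

/-- The crossings of a triangle may be renumbered cyclically. -/
theorem shift (T : D.Triangle a b p q) :
    D.Triangle (fun k => a (k + 1)) (fun k => b (k + 1)) (fun k => p (k + 1))
      (fun k => q (k + 1)) where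
  injective := by
    have hf : Function.Injective (fun k : Fin 3 => k + 1) := add_left_injective 1
    have h := T.injective.comp ((hf.sumMap hf).sumMap (hf.sumMap hf))
    convert h using 1
    ext ((k | k) | (k | k)) <;> rfl
  rot_a k := T.rot_a _
  rot_b k := T.rot_b _
  rot_p k := T.rot_p _
  rot_q k := T.rot_q _
  opp_p k := T.opp_p _
  outer_ne := by rw [T.region_p]; exact T.outer_ne
  region_eq d hd := by
    rw [T.region_p] at hd
    obtain ⟨k, rfl⟩ := T.region_eq d hd
    exact ⟨k + 2, congrArg p (fin_three_add_two_one k).symm⟩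

theorem thin (T : D.Triangle a b p q) (h : D.Alternating s) :
    (D.thin s h).Triangle a b p q :=
  ⟨T.injective, T.rot_a, T.rot_b, T.rot_p, T.rot_q, T.opp_p, T.outer_ne, T.region_eq⟩

theorem alternating_p (T : D.Triangle a b p q) (h : D.Alternating s) (k : Fin 3) :
    s (p k) = (D.mark (a k)).pass (s (a k)) := by
  rw [← h.crossing _ (T.mark_a_ne k), T.rot_a, T.rot_b]

theorem alternating_q (T : D.Triangle a b p q) (h : D.Alternating s) (k : Fin 3) :
    s (q k) = (D.mark (a k)).pass (s (b k)) := by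
  rw [← Mark.pass_next, ← T.mark_b, ← h.crossing _ (by simp [T.mark_b, T.mark_a_ne]), T.rot_b,
    T.rot_p]

/-- Comparison of the ends of a strand through two crossings of a triangle. -/
theorem alternating_b (T : D.Triangle a b p q) (h : D.Alternating s) (k : Fin 3) :
    s (b (k + 1)) = !(D.mark (a (k + 1))).pass ((D.mark (a k)).pass (s (a k))) := by
  have h1 := h.opp (p k)
  rw [T.opp_p, T.alternating_p h, T.alternating_q h] at h1
  rw [← Mark.pass_not, ← h1, Mark.pass_pass]

end Triangle

namespace ThirdMove

/-- If one of the three crossings is classical, then the other two are both virtual or both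
classical. -/
theorem levels_pass (f : ThirdMove D E) (k : Fin 3) (hk : D.mark (f.a k) ≠ Mark.virt) :
    (D.mark (f.a (k + 1))).pass = (D.mark (f.a (k + 2))).pass := by
  have hne := f.triangle.mark_a_ne
  obtain ⟨j, h1, h2⟩ := f.levels
  rw [f.triangle.mark_b] at h1
  have hpass : ∀ i, D.mark (f.a i) ≠ Mark.virt → (D.mark (f.a i)).pass = id := fun i hi => by
    have := hne i
    rcases hm : D.mark (f.a i) <;> first | contradiction | (ext b; rfl)
  by_cases hv : D.mark (f.a j) = Mark.virt
  · have hv' : D.mark (f.a (j + 1)) = Mark.virt := by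
      rw [hv] at h1
      rcases hm : D.mark (f.a (j + 1)) <;> rw [hm] at h1 <;>
        first | rfl | exact absurd h1 (by simp [Mark.next])
    obtain rfl | rfl | rfl := fin_three_cases k j
    · contradiction
    · contradiction
    · rw [fin_three_add_two_one, fin_three_add_two_two, hv, hv']
  · have h3 : D.mark (f.a (j + 2)) ≠ Mark.virt := h2.resolve_left hv
    have h4 : D.mark (f.a (j + 1)) ≠ Mark.virt := fun h => hv (by rw [h1, h]; rfl)
    have hall : ∀ i, D.mark (f.a i) ≠ Mark.virt := fun i => by
      obtain rfl | rfl | rfl := fin_three_cases i j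
      all_goals assumption
    rw [hpass _ (hall _), hpass _ (hall _)]

theorem mark_dart_b' (f : ThirdMove D E) (k : Fin 3) :
    E.mark (f.dart (f.b k)) = D.mark (f.a (k + 2)) := by
  rw [← f.mark_dart_b, fin_three_add_two_one]

theorem rot_dart_b (f : ThirdMove D E) (k : Fin 3) :
    E.rot (f.dart (f.b k)) = f.dart (f.a (k + 1)) := f.triangle'.rot_a k

theorem rot_dart_a (f : ThirdMove D E) (k : Fin 3) :
    E.rot (f.dart (f.a (k + 1))) = f.dart (f.q k) := f.triangle'.rot_b k

theorem rot_dart_q (f : ThirdMove D E) (k : Fin 3) :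
    E.rot (f.dart (f.q k)) = f.dart (f.p (k + 1)) := f.triangle'.rot_p k

theorem rot_dart_p (f : ThirdMove D E) (k : Fin 3) :
    E.rot (f.dart (f.p (k + 1))) = f.dart (f.b k) := f.triangle'.rot_q k

theorem outside_symm (f : ThirdMove D E) {d : E.Dart}
    (hd : ∀ k, d ≠ f.dart (f.b k) ∧ d ≠ f.dart (f.a (k + 1)) ∧ d ≠ f.dart (f.q k) ∧
      d ≠ f.dart (f.p (k + 1))) (k : Fin 3) :
    f.dart.symm d ≠ f.a k ∧ f.dart.symm d ≠ f.b k ∧ f.dart.symm d ≠ f.p k ∧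
      f.dart.symm d ≠ f.q k := by
  have h := hd (k + 2)
  rw [fin_three_add_two_one] at h
  simp only [ne_eq, Equiv.symm_apply_eq]
  exact ⟨h.2.1, (hd k).1, h.2.2.2, (hd k).2.2.1⟩

/-- The inverse of a third move is a third move. -/
def symm (f : ThirdMove D E) : ThirdMove E D where
  dart := f.dart.symm
  reg := f.reg.symm
  a k := f.dart (f.b k)
  b k := f.dart (f.a (k + 1))
  p k := f.dart (f.q k)
  q k := f.dart (f.p (k + 1))
  triangle := f.triangle'
  triangle' := by simpa using f.triangle.shift
  opp_dart d := by rw [Equiv.eq_symm_apply, ← f.opp_dart, Equiv.apply_symm_apply]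
  rot_dart d hd := by
    rw [Equiv.eq_symm_apply, ← f.rot_dart _ (f.outside_symm hd), Equiv.apply_symm_apply]
  mark_dart d hd := by
    rw [← f.mark_dart _ (f.outside_symm hd), Equiv.apply_symm_apply]
  mark_dart_a k := by
    rw [Equiv.symm_apply_apply, f.mark_dart_a, fin_three_add_one_one, fin_three_add_one_two]
  mark_dart_b k := by
    rw [Equiv.symm_apply_apply, f.mark_dart_b', fin_three_add_one_one]
  region_dart d hd := by
    rw [Equiv.eq_symm_apply, ← f.region_dart, Equiv.apply_symm_apply]
    intro k
    refine ⟨fun he => (hd (k + 2)).2 ?_, fun he => (hd k).1 ?_⟩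
    · rw [fin_three_add_two_one, ← he, Equiv.apply_symm_apply]
    · rw [← he, Equiv.apply_symm_apply]
  outer_reg := by rw [Equiv.symm_apply_eq, f.outer_reg]
  levels := by
    obtain ⟨k, h1, h2⟩ := f.levels
    refine ⟨k + 1, ?_⟩
    rw [fin_three_add_one_two, f.mark_dart_b, fin_three_add_one_one, fin_three_add_one_two,
      f.mark_dart_a, f.mark_dart_b']
    exact ⟨h1, h2⟩

theorem opp_ne_side (f : ThirdMove D E) {d : D.Dart} (hd : ∀ k, d ≠ f.p k ∧ d ≠ f.q k)
    (k : Fin 3) : D.opp d ≠ f.p k ∧ D.opp d ≠ f.q k := by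
  refine ⟨fun he => (hd (k + 1)).2 ?_, fun he => (hd (k + 2)).1 ?_⟩
  · rw [← f.triangle.opp_p, ← he, D.opp_opp]
  · rw [← f.triangle.opp_q, fin_three_add_two_one, ← he, D.opp_opp]

theorem rot_ne_end (f : ThirdMove D E) {d : D.Dart}
    (hd : ∀ k, d ≠ f.a k ∧ d ≠ f.b k ∧ d ≠ f.p k ∧ d ≠ f.q k) (k : Fin 3) :
    D.rot d ≠ f.a k ∧ D.rot d ≠ f.b k ∧ D.rot d ≠ f.p k ∧ D.rot d ≠ f.q k :=
  ⟨fun he => (hd k).2.2.2 (D.rot.injective (he.trans (f.triangle.rot_q k).symm)),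
    fun he => (hd k).1 (D.rot.injective (he.trans (f.triangle.rot_a k).symm)),
    fun he => (hd k).2.1 (D.rot.injective (he.trans (f.triangle.rot_b k).symm)),
    fun he => (hd k).2.2.1 (D.rot.injective (he.trans (f.triangle.rot_p k).symm))⟩

theorem mark_dart_ne (f : ThirdMove D E) (k : Fin 3) :
    E.mark (f.dart (f.a k)) ≠ Mark.point ∧ E.mark (f.dart (f.b k)) ≠ Mark.point ∧
      E.mark (f.dart (f.p k)) = (E.mark (f.dart (f.a k))).next.next ∧
      E.mark (f.dart (f.q k)) = (E.mark (f.dart (f.b k))).next.next := by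
  obtain ⟨k, rfl⟩ : ∃ j, k = j + 1 := ⟨k + 2, (fin_three_add_two_one k).symm⟩
  have h1 := f.triangle'.mark_b k
  have h2 := f.triangle'.mark_q k
  have h3 := f.triangle'.mark_a_ne (k + 1)
  have h4 := f.triangle'.mark_a_ne k
  refine ⟨?_, h3, ?_, f.triangle'.mark_p (k + 1)⟩
  · rw [h1]; simpa using h4
  · rw [h1]; exact h2

theorem rot_rot_dart (f : ThirdMove D E) (k : Fin 3) :
    E.rot (E.rot (f.dart (f.a k))) = f.dart (f.p k) ∧
    E.rot (E.rot (f.dart (f.b k))) = f.dart (f.q k) ∧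
    E.rot (E.rot (f.dart (f.p k))) = f.dart (f.a k) ∧
    E.rot (E.rot (f.dart (f.q k))) = f.dart (f.b k) := by
  obtain ⟨k, rfl⟩ : ∃ j, k = j + 1 := ⟨k + 2, (fin_three_add_two_one k).symm⟩
  refine ⟨?_, ?_, ?_, ?_⟩
  · rw [f.rot_dart_a, f.rot_dart_q]
  · rw [f.rot_dart_b, f.rot_dart_a]
  · rw [f.rot_dart_p, f.rot_dart_b]
  · rw [f.rot_dart_q, f.rot_dart_p]

/-- An alternating direction extends over a third move: both a strand and its image pass
the same two kinds of crossings, only in the opposite order, so that the values at the ends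
agree, and only those on the sides of the triangle have to be adapted. -/
theorem exists_alternating (f : ThirdMove D E) (h : D.Alternating s) :
    ∃ t, E.Alternating t ∧ ∀ d, (∀ k, d ≠ f.p k ∧ d ≠ f.q k) → t (f.dart d) = s d := by
  have T := f.triangle
  have hinj : Function.Injective (Sum.elim f.p f.q) := T.injective.comp Sum.inr_injective
  let u := Function.extend (Sum.elim f.p f.q)
    (Sum.elim (fun k => (E.mark (f.dart (f.a k))).pass (s (f.a k)))
      (fun k => (E.mark (f.dart (f.b k))).pass (s (f.b k)))) s
  have hup : ∀ k, u (f.p k) = (E.mark (f.dart (f.a k))).pass (s (f.a k)) := fun k =>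
    hinj.extend_apply _ _ (Sum.inl k)
  have huq : ∀ k, u (f.q k) = (E.mark (f.dart (f.b k))).pass (s (f.b k)) := fun k =>
    hinj.extend_apply _ _ (Sum.inr k)
  have hu : ∀ d, (∀ k, d ≠ f.p k ∧ d ≠ f.q k) → u d = s d := fun d hd =>
    Function.extend_apply' _ _ _ (by
      rintro ⟨k | k, rfl⟩
      · exact (hd k).1 rfl
      · exact (hd k).2 rfl)
  clear_value u
  have hua : ∀ k, u (f.a k) = s (f.a k) := fun k =>
    hu _ (T.a_ne_side k)
  have hub : ∀ k, u (f.b k) = s (f.b k) := fun k =>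
    hu _ (T.b_ne_side k)
  have hside : ∀ k, u (f.q (k + 1)) = !u (f.p k) := fun k => by
    rw [hup, huq, f.mark_dart_a, f.mark_dart_b, T.mark_b, T.alternating_b h]
    simp
  have hopp : ∀ d, u (D.opp d) = !u d := fun d => by
    by_cases hd : ∀ k, d ≠ f.p k ∧ d ≠ f.q k
    · rw [hu d hd, hu _ (f.opp_ne_side hd), h.opp]
    · push Not at hd
      obtain ⟨k, hk⟩ := hd
      by_cases hp : d = f.p k
      · rw [hp, T.opp_p, hside]
      · obtain ⟨j, rfl⟩ : ∃ j, k = j + 1 := ⟨k + 2, (fin_three_add_two_one k).symm⟩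
        rw [hk hp, T.opp_q, hside]
        simp
  have hcase : ∀ P : D.Dart → Prop,
      (∀ d, (∀ k, d ≠ f.a k ∧ d ≠ f.b k ∧ d ≠ f.p k ∧ d ≠ f.q k) → P d) →
      (∀ k, P (f.a k) ∧ P (f.b k) ∧ P (f.p k) ∧ P (f.q k)) → ∀ d, P d := by
    intro P h1 h2 d
    by_contra hP
    refine hP (h1 d fun k => ⟨?_, ?_, ?_, ?_⟩) <;> rintro rfl
    · exact hP (h2 k).1
    · exact hP (h2 k).2.1
    · exact hP (h2 k).2.2.1
    · exact hP (h2 k).2.2.2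
  refine ⟨u ∘ f.dart.symm, ⟨?_, ?_, ?_⟩, fun d hd => by simpa using hu d hd⟩ <;>
    refine f.dart.forall_congr_right.1 ?_
  · intro d
    rw [f.opp_dart]
    simpa using hopp d
  · refine hcase _ (fun d hd => ?_) (fun k => ?_)
    · rw [f.mark_dart d hd, f.rot_dart d hd]
      simp only [Function.comp, Equiv.symm_apply_apply]
      rw [hu d fun k => (hd k).2.2, hu _ fun k => (f.rot_ne_end hd k).2.2]
      exact h.point d
    · obtain ⟨h1, h2, h3, h4⟩ := f.mark_dart_ne k
      simp [h1, h2, h3, h4]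
  · refine hcase _ (fun d hd => ?_) (fun k => ?_)
    · rw [f.mark_dart d hd, f.rot_dart d hd, f.rot_dart _ (f.rot_ne_end hd)]
      simp only [Function.comp, Equiv.symm_apply_apply]
      rw [hu d fun k => (hd k).2.2, hu _ fun k => (f.rot_ne_end (f.rot_ne_end hd) k).2.2]
      exact h.crossing d
    · obtain ⟨h1, h2, h3, h4⟩ := f.mark_dart_ne k
      obtain ⟨r1, r2, r3, r4⟩ := f.rot_rot_dart k
      simp [r1, r2, r3, r4, h3, h4, hup, huq, hua, hub]

/-- In a triangle with three classical crossings, the number of odd ones is even.  So the odd ones,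
if any, are the two crossings on one of the strands, and this strand becomes virtual in
the triangle. -/
theorem levels_thin (f : ThirdMove D E) (h : D.Alternating s) :
    ∃ k, (D.thin s h).mark (f.a k) = (D.thin s h).mark (f.b (k + 1)) ∧
      ((D.thin s h).mark (f.a k) = Mark.virt ∨ (D.thin s h).mark (f.a (k + 2)) ≠ Mark.virt) := by
  have T := f.triangle
  have hne := T.mark_a_ne
  obtain ⟨j, h1, h2⟩ := f.levels
  by_cases hv : D.mark (f.a j) = Mark.virt
  · have h3 : (D.thin s h).mark (f.a j) = Mark.virt := by rw [thin_mark, hv]; rfl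
    have h4 : (D.thin s h).mark (f.b (j + 1)) = Mark.virt := by rw [thin_mark, ← h1, hv]; rfl
    exact ⟨j, h3.trans h4.symm, .inl h3⟩
  have h3 : D.mark (f.a (j + 2)) ≠ Mark.virt := h2.resolve_left hv
  have h4 : D.mark (f.a (j + 1)) ≠ Mark.virt := fun h => hv (by rw [h1, T.mark_b, h]; rfl)
  have hall : ∀ i, D.mark (f.a i) ≠ Mark.virt := fun i => by
    obtain rfl | rfl | rfl := fin_three_cases i j
    all_goals assumption
  have hpass : ∀ i x, (D.mark (f.a i)).pass x = x := fun i x => by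
    have h5 := hne i
    have h6 := hall i
    rcases hm : D.mark (f.a i) <;> first | contradiction | rfl
  have hb : ∀ k, s (f.b k) = !s (f.a (k + 2)) := fun k => by
    have := T.alternating_b h (k + 2)
    rwa [fin_three_add_two_one, hpass, hpass] at this
  have hodd : ∀ k, s (f.a k) ≠ s (f.a (k + 2)) → (D.thin s h).mark (f.a k) = Mark.virt := by
    intro k hk
    have : (s (f.a k) == s (f.b k)) = true := by
      rw [hb]; cases hx : s (f.a k) <;> cases hy : s (f.a (k + 2)) <;> simp_all
    rw [thin_mark, T.rot_a, this]
    have h5 := hne k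
    rcases hm : D.mark (f.a k) <;> first | contradiction | rfl
  have hcount : ∀ X : Fin 3 → Bool,
      (∀ k, X k = X (k + 2)) ∨ ∃ k, X k ≠ X (k + 2) ∧ X (k + 1) ≠ X (k + 1 + 2) := by decide
  rcases hcount fun k => s (f.a k) with heven | ⟨k, hk, hk'⟩
  · have heq : ∀ k, (D.thin s h).mark (f.a k) = D.mark (f.a k) := fun k => by
      have : (s (f.a k) == s (f.b k)) = false := by rw [hb, ← heven k]; simp
      rw [thin_mark, T.rot_a, this]
      cases D.mark (f.a k) <;> rfl
    have heq' : ∀ k, (D.thin s h).mark (f.b k) = D.mark (f.b k) := fun k => by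
      rw [(T.thin h).mark_b, heq, T.mark_b]
    refine ⟨j, by rw [heq, heq', h1], ?_⟩
    rw [heq, heq]
    exact h2
  · refine ⟨k, ?_, .inl (hodd k hk)⟩
    rw [(T.thin h).mark_b, hodd k hk, hodd _ hk']
    rfl

/-- Corresponding crossings of the two triangles have the same parity. -/
theorem thin_mark_dart_b (f : ThirdMove D E) (h : D.Alternating s) (k : E.Alternating t)
    (ht : ∀ d, (∀ k, d ≠ f.p k ∧ d ≠ f.q k) → t (f.dart d) = s d) (i : Fin 3) :
    (E.thin t k).mark (f.dart (f.b (i + 1))) = (D.thin s h).mark (f.a i) := by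
  have T := f.triangle
  have hta : ∀ k, t (f.dart (f.a k)) = s (f.a k) := fun k =>
    ht _ (T.a_ne_side k)
  have htb : ∀ k, t (f.dart (f.b k)) = s (f.b k) := fun k =>
    ht _ (T.b_ne_side k)
  rw [thin_mark, thin_mark, f.rot_dart_b, T.rot_a, f.mark_dart_b, hta, htb,
    fin_three_add_one_one]
  have h1 := T.alternating_b h i
  have h2 := T.alternating_b h (i + 2)
  have h3 := f.levels_pass i
  rw [fin_three_add_two_one] at h2
  rw [h1, h2]
  rcases hm : D.mark (f.a i)
  · rfl
  · rfl
  all_goals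
    rw [hm] at h3
    rw [h3 (by simp)]
    congr 1
    cases D.mark (f.a (i + 2)) <;> cases s (f.a i) <;> cases s (f.a (i + 2)) <;> rfl

/-- Thinning of a third move, for alternating directions which agree outside of the sides of the
triangle. -/
def thin (f : ThirdMove D E) (h : D.Alternating s) (k : E.Alternating t)
    (ht : ∀ d, (∀ k, d ≠ f.p k ∧ d ≠ f.q k) → t (f.dart d) = s d) :
    ThirdMove (D.thin s h) (E.thin t k) where
  __ := f
  triangle := f.triangle.thin h
  triangle' := f.triangle'.thin k
  mark_dart d hd := thin_mark_congr h k (f.mark_dart d hd) (ht d fun k => (hd k).2.2)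
    ((congrArg t (f.rot_dart d hd)).trans (ht _ fun k => (f.rot_ne_end hd k).2.2))
  mark_dart_a i := by
    obtain ⟨i, rfl⟩ : ∃ j, i = j + 1 := ⟨i + 2, (fin_three_add_two_one i).symm⟩
    have h1 := f.thin_mark_dart_b h k ht (i + 2)
    rw [fin_three_add_two_one] at h1
    refine ((f.triangle'.thin k).mark_b i).trans ((congrArg Mark.next h1).trans ?_)
    rw [fin_three_add_one_one]
    exact ((f.triangle.thin h).mark_b (i + 2)).symm
  mark_dart_b := f.thin_mark_dart_b h k ht
  levels := f.levels_thin h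

end ThirdMove
end

/-! ### Thinning of sequences of moves and descent -/

/-- An alternating direction can be carried along a step, and then thinning turns this step into a
step of the same kind. -/
theorem Step.exists_thin {D E : VirtualDiagram} (hDE : Step D E) {s : D.Dart → Bool}
    (h : D.Alternating s) :
    ∃ (t : E.Dart → Bool) (k : E.Alternating t), Step (D.thin s h) (E.thin t k) := by
  rcases hDE with (⟨⟨f⟩⟩ | ⟨⟨f⟩⟩ | ⟨⟨f⟩⟩) | ⟨⟨f⟩⟩ | ⟨⟨f⟩⟩ | ⟨⟨f⟩⟩ | ⟨⟨f⟩⟩ | ⟨⟨f⟩⟩ | ⟨⟨f⟩⟩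
  · exact ⟨_, f.alternating h, .inl (.inl ⟨f.thin h _ fun d => by simp⟩)⟩
  · obtain ⟨t, k, ht⟩ := f.exists_alternating h
    exact ⟨t, k, .inl (.inr (.inl ⟨f.thin h k ht⟩))⟩
  · exact ⟨_, f.alternating h, .inl (.inr (.inr ⟨f.thin _ h fun _ => rfl⟩))⟩
  · obtain ⟨t, k, ht⟩ := f.exists_alternating h
    exact ⟨t, k, .inr (.inl ⟨f.thin h k ht⟩)⟩
  · exact ⟨_, f.alternating h, .inr (.inr (.inl ⟨f.thin _ h fun _ => rfl⟩))⟩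
  · obtain ⟨t, k, ht⟩ := f.exists_alternating h
    exact ⟨t, k, .inr (.inr (.inr (.inl ⟨f.thin h k ht⟩)))⟩
  · exact ⟨_, f.alternating h, .inr (.inr (.inr (.inr (.inl ⟨f.thin _ h fun _ => rfl⟩))))⟩
  · obtain ⟨t, k, ht⟩ := f.exists_alternating h
    exact ⟨t, k, .inr (.inr (.inr (.inr (.inr (.inl ⟨f.thin h k ht⟩)))))⟩
  · obtain ⟨t, k, ht⟩ := f.symm.exists_alternating h
    exact ⟨t, k, .inr (.inr (.inr (.inr (.inr (.inl ⟨f.symm.thin h k ht⟩)))))⟩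

theorem Step.symm {D E : VirtualDiagram} (h : Step D E) : Step E D := by
  rcases h with (⟨⟨f⟩⟩ | h | h) | h | h | h | h | h | h
  · refine .inl (.inl ⟨⟨f.dart.symm, f.reg.symm, ?_, ?_, ?_, ?_, ?_⟩⟩)
    · intro d; rw [Equiv.eq_symm_apply, ← f.rot_dart, Equiv.apply_symm_apply]
    · intro d; rw [Equiv.eq_symm_apply, ← f.opp_dart, Equiv.apply_symm_apply]
    · intro d; rw [← f.mark_dart, Equiv.apply_symm_apply]
    · intro d; rw [Equiv.eq_symm_apply, ← f.region_dart, Equiv.apply_symm_apply]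
    · rw [Equiv.symm_apply_eq, f.outer_reg]
  all_goals simp [Step, Isotopy, ReidemeisterMove, h]

/-- One step between diagrams with orientable atoms. -/
def OrientableStep (D E : VirtualDiagram) : Prop :=
  D.HasOrientableAtom ∧ E.HasOrientableAtom ∧ Step D E

/-- A finite sequence of steps, with the total number of darts at classical crossings in all the
diagrams of the sequence. -/
inductive Chain (D : VirtualDiagram) : VirtualDiagram → ℕ → Prop
  | refl : Chain D D D.classicalCount
  | tail {E F : VirtualDiagram} {m : ℕ} : Chain D E m → Step E F →
      Chain D F (m + F.classicalCount)

theorem Equivalent.exists_chain {D E : VirtualDiagram} (h : Equivalent D E) :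
    ∃ m, Chain D E m := by
  induction h with
  | refl => exact ⟨_, .refl⟩
  | tail _ h ih => exact ih.elim fun m hm => ⟨_, hm.tail h⟩

/-- Thinning of a whole sequence.  If no classical crossing disappears, then all
the atoms are orientable. -/
theorem Chain.exists_thin {D E : VirtualDiagram} {m : ℕ} (c : Chain D E m) {s : D.Dart → Bool}
    (h : D.Alternating s) :
    ∃ (t : E.Dart → Bool) (k : E.Alternating t) (m' : ℕ), m' ≤ m ∧
      Chain (D.thin s h) (E.thin t k) m' ∧
      (m' = m → (E.thin t k).classicalCount = E.classicalCount ∧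
        Relation.ReflTransGen OrientableStep D E) := by
  induction c with
  | refl =>
    exact ⟨s, h, _, classicalCount_thin_le h, .refl, fun hc => ⟨hc, .refl⟩⟩
  | @tail E F _ c hst ih =>
    obtain ⟨t, k, m', hm, c', hc'⟩ := ih
    obtain ⟨t', k', hst'⟩ := hst.exists_thin k
    have hle := classicalCount_thin_le k'
    refine ⟨t', k', _, by omega, c'.tail hst', fun heq => ?_⟩
    have h1 : (F.thin t' k').classicalCount = F.classicalCount := by omega
    obtain ⟨h2, h3⟩ := hc' (by omega)
    exact ⟨h1, h3.tail ⟨k.orientable (even_of_classicalCount_eq k h2),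
      k'.orientable (even_of_classicalCount_eq k' h1), hst⟩⟩

/-- From a diagram with an orientable atom, each equivalent diagram `E` can be reached through
orientable atoms up to making some classical crossings of `E` virtual. -/
theorem Chain.exists_reduct {D E : VirtualDiagram} {m : ℕ} (c : Chain D E m)
    (hD : D.HasOrientableAtom) :
    ∃ R, Relation.ReflTransGen OrientableStep D R ∧ R.classicalCount ≤ E.classicalCount ∧
      (R.classicalCount = E.classicalCount → R = E) := by
  induction m using Nat.strong_induction_on generalizing E with
  | _ m ih =>
    obtain ⟨s, h, he⟩ := hD.exists_alternating
    obtain ⟨t, k, m', hm, c', hc'⟩ := c.exists_thin h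
    rcases hm.eq_or_lt with heq | hlt
    · exact ⟨E, (hc' heq).2, le_rfl, fun _ => rfl⟩
    · rw [thin_eq_self h he] at c'
      obtain ⟨R, h1, h2, h3⟩ := ih m' hlt c'
      have hle := classicalCount_thin_le k
      refine ⟨R, h1, h2.trans hle, fun hR => ?_⟩
      rw [h3 (by omega), thin_eq_self k (even_of_classicalCount_eq k (by omega))]

theorem OrientableStep.symm {D E : VirtualDiagram} (h : OrientableStep D E) :
    OrientableStep E D := ⟨h.2.1, h.1, h.2.2.symm⟩

theorem reflTransGen_symm {α : Type*} {r : α → α → Prop} (hr : ∀ {a b}, r a b → r b a) {a b : α}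
    (h : Relation.ReflTransGen r a b) : Relation.ReflTransGen r b a := by
  induction h with
  | refl => exact .refl
  | tail _ h ih => exact .head (hr h) ih

theorem hasOrientableAtom_of_reflTransGen {D E : VirtualDiagram}
    (h : Relation.ReflTransGen OrientableStep D E) (hD : D.HasOrientableAtom) :
    E.HasOrientableAtom := by
  cases h with
  | refl => exact hD
  | tail _ h => exact h.2.1

theorem equivalent_of_reflTransGen {D E : VirtualDiagram}
    (h : Relation.ReflTransGen OrientableStep D E) : Equivalent D E :=
  Relation.ReflTransGen.mono (fun _ _ (h : OrientableStep _ _) => h.2.2) _ _ h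

/-- Equivalent diagrams with orientable atoms are joined through orientable atoms, by induction on
the total number of classical crossings: each of the two is joined to a reduct of the other one, and
unless the reduct of `E` is `E` itself, the reducts have fewer classical crossings in total. -/
theorem Equivalent.reflTransGen_orientableStep {D E : VirtualDiagram} (hDE : Equivalent D E)
    (hD : D.HasOrientableAtom) (hE : E.HasOrientableAtom) :
    Relation.ReflTransGen OrientableStep D E := by
  induction hn : D.classicalCount + E.classicalCount using Nat.strong_induction_on
    generalizing D E with
  | _ n ih =>
    have hED : Equivalent E D := reflTransGen_symm Step.symm hDE
    obtain ⟨_, c⟩ := hDE.exists_chain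
    obtain ⟨_, c'⟩ := hED.exists_chain
    obtain ⟨R, h1, h2, h3⟩ := c.exists_reduct hD
    obtain ⟨R', h1', h2', h3'⟩ := c'.exists_reduct hE
    rcases h2.eq_or_lt with heq | hlt
    · exact h3 heq ▸ h1
    · have hRR : Equivalent R R' :=
        (reflTransGen_symm Step.symm (equivalent_of_reflTransGen h1)).trans
          (hDE.trans (equivalent_of_reflTransGen h1'))
      have := ih (R.classicalCount + R'.classicalCount) (by omega) hRR
        (hasOrientableAtom_of_reflTransGen h1 hD) (hasOrientableAtom_of_reflTransGen h1' hE) rfl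
      exact h1.trans (this.trans (reflTransGen_symm OrientableStep.symm h1'))

end VirtualDiagram

theorem theorem3p1 (K K' : VirtualDiagram)
    (hK : K.HasOrientableAtom) (hK' : K'.HasOrientableAtom)
    (h : VirtualDiagram.Equivalent K K') :
    ∃ (n : ℕ) (L : ℕ → VirtualDiagram), L 0 = K ∧ L n = K' ∧
      (∀ i ≤ n, (L i).HasOrientableAtom) ∧
      (∀ i < n, VirtualDiagram.Step (L i) (L (i + 1))) := by
  have hj := h.reflTransGen_orientableStep hK hK'
  clear h hK'
  induction hj with
  | refl => exact ⟨0, fun _ => K, rfl, rfl, fun _ _ => hK, fun _ hi => absurd hi (by simp)⟩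
  | @tail E F _ hst ih =>
    obtain ⟨n, L, h0, hn, ho, hs⟩ := ih
    refine ⟨n + 1, fun i => if i ≤ n then L i else F, by simpa using h0, by simp, ?_, ?_⟩
    · intro i _
      by_cases hi : i ≤ n
      · simpa [hi] using ho i hi
      · simpa [hi] using hst.2.1
    · intro i hi
      rcases (Nat.lt_succ_iff.1 hi).eq_or_lt with rfl | hi'
      · simpa [hn] using hst.2.2
      · simpa [hi'.le, Nat.succ_le_of_lt hi'] using hs i hi'
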